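/- Let $G$ be an infinite Abelian group and let $G_d$ denote $G$ with the discrete topology. For an Abelian topological group $X$, let $X^\wedge$ be the group of continuous characters $X\to\mathbb{T}$, where $\mathbb{T}$ is the unit circle in $\mathbb{C}$; thus $G_d^\wedge$ consists of all homomorphisms $G\to\mathbb{T}$. Let $S$ be a set of sequences in $G$ which is a $TBS$-set: there is at least one precompact Hausdorff group topology on $G$ in which every sequence of $S$ converges to the neutral element (precompact means that for every neighbourhood $U$ of the neutral element, finitely many translates of $U$ cover $G$). Let $\tau_{bS}$ be the finest precompact Hausdorff group topology on $G$ with this property, and let $j_S : G_d\to (G,\tau_{bS})$, $j_S(g)=g$, be the natural continuous isomorphism, with conjugate homomorphism $j_S^\wedge : (G,\tau_{bS})^\wedge\to G_d^\wedge$, $\chi\mapsto\chi\circ j_S$. Put $$ s_S(G_d^\wedge) := \{ x\in G_d^\wedge : x(u_n)\to 1 \text{ for every } \{u_n\}\in S\}. $$ For a subgroup $H\le G_d^\wedge$ let $T_H$ be the weakest topology on $G$ for which all characters in $H$ are continuous. Then: 1) $j_S^\wedge\big( (G,\tau_{bS})^\wedge\big) = s_S(G_d^\wedge)$; 2) $\tau_{bS}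 = T_{s_S(G_d^\wedge)}$. -/

import Mathlib

open Filter Topology

noncomputable section

/-- For a topology `τ` on `G`, Mathlib's `WithTopology G τ` is the space `(G, τ)` (a copy of `G`);
here it carries the group structure of `G`. In particular `WithTopology G ⊥` is the group `G` with
the discrete topology, written `G_d` below. -/
instance WithTopology.instCommGroup (G : Type*) [CommGroup G] (τ : TopologicalSpace G) :
    CommGroup (WithTopology G τ) := (WithTopology.equiv G τ).commGroup

instance WithTopology.instDiscreteTopology (G : Type*) : DiscreteTopology (WithTopology G ⊥) :=
  discreteTopology_iff_forall_isOpen.2 fun _ => trivial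

/-- The natural continuous isomorphism `j : G_d → (G, τ)`, `j g = g`, from the group `G` with
the discrete topology. -/
def WithTopology.fromDiscrete (G : Type*) [CommGroup G] (τ : TopologicalSpace G) :
    WithTopology G ⊥ →ₜ* WithTopology G τ where
  toFun g := toTopology τ g.ofTopology
  map_one' := rfl
  map_mul' _ _ := rfl
  continuous_toFun := continuous_of_discreteTopology

/-- A group topology (group written multiplicatively) is precompact (totally bounded) if `G` is
covered by finitely many translates of each neighbourhood of the neutral element. -/
def IsPrecompactTopology {G : Type*} [CommGroup G] (τ : TopologicalSpace G) : Prop :=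
  ∀ U ∈ @nhds G τ 1, ∃ F : Set G, F.Finite ∧ ∀ g : G, ∃ f ∈ F, ∃ v ∈ U, g = f * v

/-- `τ` is a precompact Hausdorff group topology on `G` in which every sequence of `S` converges to
the neutral element. -/
structure IsTBSTopology {G : Type*} [CommGroup G] (S : Set (ℕ → G))
    (τ : TopologicalSpace G) : Prop where
  isTopologicalGroup : @IsTopologicalGroup G τ _
  t2Space : @T2Space G τ
  isPrecompact : IsPrecompactTopology τ
  tendsto : ∀ u ∈ S, Tendsto u atTop (@nhds G τ 1)

/-- `S` is a `TBS`-set of sequences in `G`. -/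
def IsTBSSet {G : Type*} [CommGroup G] (S : Set (ℕ → G)) : Prop :=
  ∃ τ : TopologicalSpace G, IsTBSTopology S τ

/-- The topology `τ_{bS}`: the finest precompact Hausdorff group topology on `G` in which
every sequence of `S` converges to the neutral element. In the order on topologies used here, `τ ≤ σ`
means that `τ` is finer than `σ`, so the finest topology is the least one; that the infimum is
attained for a `TBS`-set is `isLeast_tauBS` below. -/
@[reducible] def tauBS {G : Type*} [CommGroup G] (S : Set (ℕ → G)) : TopologicalSpace G :=
  sInf {τ | IsTBSTopology S τ}

/-- Precompactness in terms of the uniform structure of the group. -/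
theorem isPrecompactTopology_iff {G : Type*} [CommGroup G] (U : UniformSpace G)
    (h : @IsUniformGroup G U _) :
    IsPrecompactTopology U.toTopologicalSpace ↔ @TotallyBounded G U Set.univ := by
  rw [totallyBounded_iff_subset_finite_iUnion_nhds_one]
  refine forall₂_congr fun V _ => exists_congr fun F => and_congr_right fun _ => ?_
  simp only [Set.subset_def, Set.mem_univ, true_imp_iff, Set.mem_iUnion, Set.mem_smul_set,
    exists_prop, smul_eq_mul, eq_comm]

/-- For a `TBS`-set there is a finest topology of the required kind, namely `tauBS S`. -/
theorem isLeast_tauBS {G : Type*} [CommGroup G] {S : Set (ℕ → G)} (hS : IsTBSSet S) :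
    IsLeast {τ | IsTBSTopology S τ} (tauBS S) := by
  refine ⟨?_, fun τ hτ => sInf_le hτ⟩
  obtain ⟨τ₀, h₀⟩ := hS
  have hgrp : @IsTopologicalGroup G (tauBS S) _ :=
    topologicalGroup_sInf fun t ht => ht.isTopologicalGroup
  refine ⟨hgrp, ?_, ?_, ?_⟩
  · exact @T2Space.mk G (tauBS S) fun x y hxy => by
      obtain ⟨u, v, hu, hv, h⟩ := @t2_separation G τ₀ h₀.t2Space x y hxy
      have hle : tauBS S ≤ τ₀ := sInf_le h₀
      exact ⟨u, v, hle u hu, hle v hv, h⟩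
  · have key : ∀ t : {τ | IsTBSTopology S τ}, ∃ U : UniformSpace G,
        U.toTopologicalSpace = t.1 ∧ @IsUniformGroup G U _ := fun t =>
      ⟨@IsTopologicalGroup.rightUniformSpace G _ t.1 t.2.isTopologicalGroup, rfl,
        @isUniformGroup_of_commGroup G _ t.1 t.2.isTopologicalGroup⟩
    choose U hU hUG using key
    have htop : (⨅ t, U t).toTopologicalSpace = tauBS S := by
      rw [UniformSpace.toTopologicalSpace_iInf, tauBS, sInf_eq_iInf']
      exact iInf_congr hU
    have hug : @IsUniformGroup G (⨅ t, U t) _ := isUniformGroup_iInf hUG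
    rw [← htop, isPrecompactTopology_iff _ hug,
      @totallyBounded_iff_ultrafilter G (⨅ t, U t) Set.univ]
    intro f _
    have : Nonempty {τ | IsTBSTopology S τ} := ⟨⟨τ₀, h₀⟩⟩
    rw [cauchy_iInf_uniformSpace]
    intro t
    have ht : @TotallyBounded G (U t) Set.univ :=
      (isPrecompactTopology_iff (U t) (hUG t)).1 ((hU t).symm ▸ t.2.isPrecompact)
    exact (@totallyBounded_iff_ultrafilter G (U t) Set.univ).1 ht f (by simp)
  · intro u hu
    rw [tauBS, nhds_sInf]
    exact tendsto_iInf.2 fun t => tendsto_iInf.2 fun ht => ht.tendsto u hu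

/-- For a sequence `u` in `G`, the subgroup `s_u(G_d^∧)` of the Pontryagin dual of the discrete group
`G` formed by the characters `x` with `x (u n) → 1`. -/
def seqSubgroup {G : Type*} [CommGroup G] (u : ℕ → G) :
    Subgroup (PontryaginDual (WithTopology G ⊥)) where
  carrier := {x | Tendsto (fun n => x (WithTopology.toTopology ⊥ (u n))) atTop (𝓝 (1 : Circle))}
  one_mem' := tendsto_const_nhds
  mul_mem' {x y} hx hy := by
    have h := Tendsto.mul hx hy
    rw [one_mul] at h
    exact h
  inv_mem' {x} hx := by
    have h := Tendsto.inv hx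
    rw [inv_one] at h
    exact h

/-- `s_S(G_d^∧)`, the intersection of the subgroups `s_u(G_d^∧)` over `u ∈ S`. -/
def seqSetSubgroup {G : Type*} [CommGroup G] (S : Set (ℕ → G)) :
    Subgroup (PontryaginDual (WithTopology G ⊥)) :=
  ⨅ u ∈ S, seqSubgroup u

/-- `T_H`: the weakest topology on `G` making every character in `H ≤ G_d^∧` continuous. -/
@[reducible] def weakTopologyOf {G : Type*} [CommGroup G]
    (H : Subgroup (PontryaginDual (WithTopology G ⊥))) : TopologicalSpace G :=
  ⨅ x ∈ H, TopologicalSpace.induced (fun g : G => x (WithTopology.toTopology ⊥ g)) inferInstance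

end

/-! Everything rests on one equivalence: a homomorphism `x : G →* Circle` is continuous for `tauBS
S` iff `x (u n) → 1` for all `u ∈ S`. If `x` satisfies the limit condition, the join of `tauBS S`
with the topology induced by `x` is again precompact, Hausdorff and makes `S` converge, so by
maximality it is no finer than `tauBS S`. This gives 1). For 2) it remains that a precompact group
topology is determined by its continuous characters (Comfort and Ross). The completion is a compact
group, and there characters separate points. That is proved through the regular representation `V`
on L²: averaging `V` against a matrix coefficient gives a self-adjoint `C`, commuting with `V`, such
that `g ↦ V g * C` is norm continuous. All of these lie in a commutative C⋆-algebra, and a Gelfand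
character of it, composed with `V`, is the required character of the group. -/

/-! ### Group characters from Gelfand theory. -/

open WeakDual in
/-- A character of a commutative C⋆-algebra maps unitaries to the unit circle. -/
theorem norm_characterSpace_apply_unitary {A : Type*} [CommCStarAlgebra A]
    (φ : characterSpace ℂ A) {u : A} (hu : u ∈ unitary A) : ‖φ u‖ = 1 := by
  have h : φ u * star (φ u) = 1 := by
    rw [← map_star, ← map_mul, Unitary.mul_star_self_of_mem hu, map_one]
  have h2 : ‖φ u‖ * ‖φ u‖ = 1 := by
    rw [← norm_star (φ u)]
    nth_rewrite 1 [norm_star]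
    rw [← norm_mul, h, norm_one]
  nlinarith [norm_nonneg (φ u)]

-- Gelfand theory gives `φ` with `φ (V a) * φ c ≠ φ c`, so `φ c ≠ 0` and `φ (V a) ≠ 1`. Only `V g *
-- c` is norm continuous, but dividing `φ (V g * c)` by `φ c` recovers continuity of `φ ∘ V`.
open WeakDual in
theorem exists_character_apply_ne_one_of_commCStarAlgebra {A K : Type*} [CommCStarAlgebra A]
    [CommGroup K] [TopologicalSpace K] (V : K →* A) (hV : ∀ g, V g ∈ unitary A) (c : A)
    (hcont : Continuous fun g => V g * c) {a : K} (ha : V a * c ≠ c) :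
    ∃ χ : K →ₜ* Circle, χ a ≠ 1 := by
  obtain ⟨φ, hφ⟩ : ∃ φ : characterSpace ℂ A, φ (V a * c) ≠ φ c := by
    by_contra! h
    exact ha ((gelfandTransform_isometry A).injective (ContinuousMap.ext h))
  rw [map_mul] at hφ
  have hc : φ c ≠ 0 := fun h => hφ (by simp [h])
  have hcts : Continuous fun g => φ (V g) := by
    have h : Continuous fun g => φ (V g * c) / φ c :=
      ((map_continuous φ).comp hcont).div_const _
    simpa [map_mul, hc] using h
  refine ⟨{ toFun := fun g => ⟨φ (V g), mem_sphere_zero_iff_norm.2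
              (norm_characterSpace_apply_unitary φ (hV g))⟩
            map_one' := Circle.ext (by simp)
            map_mul' := fun x y => Circle.ext ((congrArg φ (V.map_mul x y)).trans (map_mul φ _ _))
            continuous_toFun := hcts.subtype_mk _ }, fun h => hφ ?_⟩
  have h1 : φ (V a) = 1 := congrArg Subtype.val h
  rw [h1, one_mul]

/-- If a unitary representation of an abelian group in a C⋆-algebra becomes norm continuous after
multiplication by a self-adjoint element commuting with it, and `a` acts nontrivially on that
element, then a continuous character separates `a` from `1`. -/
theorem exists_character_apply_ne_one_of_cstarAlgebra {B K : Type*} [CStarAlgebra B] [CommGroup K]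
    [TopologicalSpace K] (V : K →* B) (hV : ∀ g, V g ∈ unitary B) (c : B) (hc : IsSelfAdjoint c)
    (hcomm : ∀ g, V g * c = c * V g) (hcont : Continuous fun g => V g * c) {a : K}
    (ha : V a * c ≠ c) : ∃ χ : K →ₜ* Circle, χ a ≠ 1 := by
  have hcs : c ∈ (StarSubalgebra.centralizer ℂ (insert c (Set.range V))) := by
    rw [StarSubalgebra.mem_centralizer_iff]
    rintro _ (rfl | ⟨g, rfl⟩)
    · simp [hc.star_eq]
    · refine ⟨hcomm g, ?_⟩
      have := congrArg star (hcomm g)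
      simpa [hc.star_eq] using this.symm
  have hstar : ∀ g, star (V g) = V g⁻¹ := fun g => by
    have h1 : V g⁻¹ * V g = 1 := by rw [← map_mul]; simp
    calc star (V g) = V g⁻¹ * V g * star (V g) := by rw [h1, one_mul]
      _ = V g⁻¹ := by rw [mul_assoc, Unitary.mul_star_self_of_mem (hV g), mul_one]
  have hVs : ∀ g, V g ∈ (StarSubalgebra.centralizer ℂ (insert c (Set.range V))) := by
    intro g
    rw [StarSubalgebra.mem_centralizer_iff]
    rintro _ (rfl | ⟨h, rfl⟩)
    · rw [hc.star_eq]
      exact ⟨(hcomm g).symm, (hcomm g).symm⟩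
    · rw [hstar, ← map_mul, ← map_mul, ← map_mul, ← map_mul]
      exact ⟨by rw [mul_comm], by rw [mul_comm]⟩
  set s : Set B := insert c (Set.range V) with hs
  -- Elements of `s` commute with each other and with each other's adjoints, so the double
  -- centralizer is commutative; as a centralizer it is also norm closed.
  set A : StarSubalgebra ℂ B :=
    StarSubalgebra.centralizer ℂ (StarSubalgebra.centralizer ℂ s : Set B) with hA
  have hsA : ∀ x ∈ s, x ∈ A := fun x hx => by
    rw [hA, StarSubalgebra.mem_centralizer_iff]
    intro y hy
    have h1 := (StarSubalgebra.mem_centralizer_iff ℂ).1 hy x hx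
    have h2 := (StarSubalgebra.mem_centralizer_iff ℂ).1 (star_mem hy) x hx
    exact ⟨h1.1.symm, h2.1.symm⟩
  have hsub : s ⊆ StarSubalgebra.centralizer ℂ s := by
    rintro _ (rfl | ⟨h, rfl⟩)
    exacts [hcs, hVs h]
  have hAcomm : ∀ x y : A, x * y = y * x := fun x y => by
    have hy : (y : B) ∈ StarSubalgebra.centralizer ℂ s := by
      rw [StarSubalgebra.mem_centralizer_iff]
      exact fun g hg => (StarSubalgebra.mem_centralizer_iff ℂ).1 y.2 g (hsub hg)
    exact Subtype.ext ((StarSubalgebra.mem_centralizer_iff ℂ).1 x.2 _ hy).1.symm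
  have hclosed : IsClosed (A : Set B) := by
    rw [hA, StarSubalgebra.coe_centralizer]
    exact Set.isClosed_centralizer _
  let _ : CommCStarAlgebra A :=
    { StarSubalgebra.cstarAlgebra A (h_closed := hclosed) with mul_comm := hAcomm }
  let W : K →* A :=
    { toFun := fun g => ⟨V g, hsA _ (.inr ⟨g, rfl⟩)⟩
      map_one' := Subtype.ext V.map_one
      map_mul' := fun x y => Subtype.ext (V.map_mul x y) }
  refine exists_character_apply_ne_one_of_commCStarAlgebra W (fun g => ?_)
    ⟨c, hsA c (.inl rfl)⟩ (hcont.subtype_mk _) (fun h => ha (congrArg Subtype.val h))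
  rw [Unitary.mem_iff]
  exact ⟨Subtype.ext (Unitary.star_mul_self_of_mem (hV g)),
    Subtype.ext (Unitary.mul_star_self_of_mem (hV g))⟩

/-! ### Unitary representations of compact abelian groups. -/

section UnitaryRepresentation

variable {K H : Type*} [CommGroup K] [NormedAddCommGroup H] [InnerProductSpace ℂ H]

open MeasureTheory

theorem inner_map_map_of_norm_map {T : H →L[ℂ] H} (hT : ∀ x, ‖T x‖ = ‖x‖) (x y : H) :
    inner ℂ (T x) (T y) = inner ℂ x y :=
  (⟨T.toLinearMap, hT⟩ : H →ₗᵢ[ℂ] H).inner_map_map x y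

theorem inner_map_eq_inner_map_inv {V : K →* (H →L[ℂ] H)} (hV : ∀ g x, ‖V g x‖ = ‖x‖)
    (g : K) (x y : H) : inner ℂ (V g x) y = inner ℂ x (V g⁻¹ y) := by
  rw [← inner_map_map_of_norm_map (hV g⁻¹) (V g x) y, ← mul_apply_eq_comp, ← map_mul]
  simp

theorem mem_unitary_of_norm_map [CompleteSpace H] {V : K →* (H →L[ℂ] H)} (hV : ∀ g x, ‖V g x‖ = ‖x‖) (g : K) :
    V g ∈ unitary (H →L[ℂ] H) := by
  have hs : star (V g) = V g⁻¹ := by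
    rw [ContinuousLinearMap.star_eq_adjoint, eq_comm, ContinuousLinearMap.eq_adjoint_iff]
    intro x y
    simpa using inner_map_eq_inner_map_inv hV g⁻¹ x y
  rw [Unitary.mem_iff, hs, ← map_mul, ← map_mul]
  simp

/-- A strongly continuous unitary representation of a compact abelian group has a continuous
character separating `a` from `1` as soon as some matrix coefficient `φ` of a nonzero vector
and its translate by `a` have disjoint supports. -/
theorem exists_character_apply_ne_one_of_unitaryRepresentation
    [CompleteSpace H] [TopologicalSpace K] [IsTopologicalGroup K] [CompactSpace K]
    {V : K →* (H →L[ℂ] H)} (hV : ∀ g x, ‖V g x‖ = ‖x‖)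
    (hcont : ∀ x, Continuous fun g => V g x) {a : K} {k : H} (hk : k ≠ 0)
    (hsupp : ∀ g, inner ℂ (V g k) k = 0 ∨ inner ℂ (V (a * g) k) k = 0) :
    ∃ χ : K →ₜ* Circle, χ a ≠ 1 := by
  borelize K
  set μ : Measure K := Measure.haar
  set φ : K → ℂ := fun g => inner ℂ (V g k) k with hφ
  have hφc : Continuous φ := (hcont k).inner continuous_const
  have hint : ∀ {E : Type _} [NormedAddCommGroup E] {f : K → E}, Continuous f → Integrable f μ :=
    fun hf => hf.integrable_of_hasCompactSupport (HasCompactSupport.of_compactSpace _)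
  have hci : ∀ b x, Continuous fun g => φ (b * g) • V g x := fun b x =>
    (hφc.comp (continuous_const_mul b)).smul (hcont x)
  obtain ⟨M, hM⟩ : ∃ M, ∀ g, ‖φ g‖ ≤ M := by
    obtain ⟨M, hM⟩ := (isCompact_range hφc).isBounded.exists_norm_le
    exact ⟨M, fun g => hM _ ⟨g, rfl⟩⟩
  -- The integral of `φ g • V g` is taken vector by vector, since `V` is only strongly continuous.
  let C : H →L[ℂ] H := LinearMap.mkContinuous
    { toFun := fun x => ∫ g, φ g • V g x ∂μ
      map_add' := fun x y => by
        simp only [map_add, smul_add]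
        exact integral_add (hint (by simpa using hci 1 x)) (hint (by simpa using hci 1 y))
      map_smul' := fun r x => by
        simp only [map_smul, smul_comm _ r, RingHom.id_apply]
        exact integral_smul _ _ } (M * μ.real Set.univ) fun x => by
      refine (norm_integral_le_of_norm_le_const (C := M * ‖x‖) (.of_forall fun g => ?_)).trans
        (le_of_eq (by ring))
      rw [norm_smul, hV]
      exact mul_le_mul_of_nonneg_right (hM g) (norm_nonneg _)
  have hC : ∀ x, C x = ∫ g, φ g • V g x ∂μ := fun x => rfl
  have hVC : ∀ b x, V b (C x) = ∫ g, φ (b⁻¹ * g) • V g x ∂μ := fun b x => by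
    rw [hC, ← ContinuousLinearMap.integral_comp_comm _ (hint (by simpa using hci 1 x)),
      ← integral_mul_left_eq_self (fun g => φ (b⁻¹ * g) • V g x) b]
    simp [map_mul]
  -- This combines `φ g⁻¹ = conj (φ g)`, unitarity of `V`, and invariance of Haar measure under
  -- inversion.
  have hself : IsSelfAdjoint C := by
    rw [ContinuousLinearMap.isSelfAdjoint_iff_isSymmetric]
    intro x y
    have h1 : inner ℂ x (C y) = ∫ g, φ g * inner ℂ x (V g y) ∂μ := by
      rw [hC, ← integral_inner (hint (by simpa using hci 1 y))]
      simp [inner_smul_right]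
    have h2 : inner ℂ (C x) y = ∫ g, φ g⁻¹ * inner ℂ x (V g⁻¹ y) ∂μ := by
      rw [← inner_conj_symm, hC, ← integral_inner (hint (by simpa using hci 1 x)), ← integral_conj]
      congr 1 with g
      rw [inner_smul_right, map_mul, inner_conj_symm, inner_conj_symm, inner_map_eq_inner_map_inv hV]
      simp only [hφ]
      rw [inner_map_eq_inner_map_inv hV g⁻¹, inv_inv]
    change inner ℂ (C x) y = inner ℂ x (C y)
    rw [h1, h2, integral_inv_eq_self (fun g => φ g * inner ℂ x (V g y))]
  have hcomm : ∀ g, V g * C = C * V g := fun b => by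
    ext x
    rw [mul_apply_eq_comp, mul_apply_eq_comp, hC, hC,
      ← ContinuousLinearMap.integral_comp_comm _ (hint (by simpa using hci 1 x))]
    congr 1 with g
    rw [map_smul, ← mul_apply_eq_comp, ← map_mul, mul_comm, map_mul]
    rfl
  have hφdist : ∀ b c g, ‖φ (b * g) - φ (c * g)‖ ≤ ‖V b k - V c k‖ * ‖k‖ := fun b c g => by
    have h : φ (b * g) - φ (c * g) = inner ℂ (V g (V b k - V c k)) k := by
      simp only [hφ]
      rw [mul_comm b, mul_comm c, map_mul, map_mul, map_sub, inner_sub_left]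
      rfl
    rw [h, ← hV g (V b k - V c k)]
    exact norm_inner_le_norm _ _
  -- Translating the integral moves `b` into the coefficient `φ`, so strong continuity at the single
  -- vector `k` becomes norm continuity.
  have hnorm : ∀ b c, ‖V b * C - V c * C‖ ≤ ‖V b⁻¹ k - V c⁻¹ k‖ * ‖k‖ * μ.real Set.univ := by
    intro b c
    refine ContinuousLinearMap.opNorm_le_bound _ (by positivity) fun x => ?_
    rw [_root_.sub_apply, mul_apply_eq_comp,
      mul_apply_eq_comp, hVC, hVC, ← integral_sub (hint (hci _ _)) (hint (hci _ _))]
    refine (norm_integral_le_of_norm_le_const (C := ‖V b⁻¹ k - V c⁻¹ k‖ * ‖k‖ * ‖x‖)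
      (.of_forall fun g => ?_)).trans (le_of_eq (by ring))
    rw [← sub_smul, norm_smul, hV]
    exact mul_le_mul_of_nonneg_right (hφdist _ _ _) (norm_nonneg _)
  refine exists_character_apply_ne_one_of_cstarAlgebra V (mem_unitary_of_norm_map hV) C hself hcomm
    (continuous_iff_continuousAt.2 fun c => ?_) (a := a) fun hac => ?_
  · rw [ContinuousAt, tendsto_iff_norm_sub_tendsto_zero]
    refine squeeze_zero (fun _ => norm_nonneg _) (fun b => hnorm b c) ?_
    have h : Continuous fun b => ‖V b⁻¹ k - V c⁻¹ k‖ * ‖k‖ * μ.real Set.univ :=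
      (((((hcont k).comp continuous_inv).sub continuous_const).norm).mul continuous_const).mul
        continuous_const
    simpa using h.tendsto c
  -- If `V a * C = C`, the two pairings with `k` agree; but one is `∫ ‖φ‖² > 0`, as `φ 1 = ‖k‖² ≠
  -- 0`, and the other vanishes by disjointness of supports.
  · have h1 : inner ℂ k (C k) = ((∫ g, ‖φ g‖ ^ 2 ∂μ : ℝ) : ℂ) := by
      rw [hC, ← integral_inner (hint (by simpa using hci 1 k)), ← integral_complex_ofReal]
      congr 1 with g
      rw [inner_smul_right, ← inner_conj_symm, Complex.mul_conj']
      push_cast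
      rfl
    have h2 : inner ℂ k (V a (C k)) = 0 := by
      rw [hVC, ← integral_inner (hint (hci _ _))]
      refine integral_eq_zero_of_ae (.of_forall fun g => ?_)
      change inner ℂ k (φ (a⁻¹ * g) • V g k) = 0
      rw [inner_smul_right, mul_eq_zero, ← inner_conj_symm, map_eq_zero]
      simpa [hφ] using hsupp (a⁻¹ * g)
    have h3 : V a (C k) = C k := congrArg (fun T => T k) hac
    rw [h3, h1, Complex.ofReal_eq_zero] at h2
    have hpos : 0 < ∫ g, ‖φ g‖ ^ 2 ∂μ :=
      (hφc.norm.pow 2).integral_pos_of_hasCompactSupport_nonneg_nonzero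
        (HasCompactSupport.of_compactSpace _) (fun g => by positivity) (x := 1) (by simp [hφ, hk])
    exact hpos.ne' h2

end UnitaryRepresentation

/-! ### Characters of compact abelian groups. -/

section CompactGroup

open MeasureTheory DomMulAct
open scoped ENNReal Pointwise

/-- Continuous characters separate the points of a compact Hausdorff abelian group. -/
theorem exists_character_apply_ne_one {K : Type*} [CommGroup K] [TopologicalSpace K]
    [IsTopologicalGroup K] [CompactSpace K] [T2Space K] {a : K} (ha : a ≠ 1) :
    ∃ χ : K →ₜ* Circle, χ a ≠ 1 := by
  borelize K
  set μ : Measure K := Measure.haar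
  have : Fact ((2 : ℝ≥0∞) ≠ ∞) := ⟨ENNReal.ofNat_ne_top⟩
  let V : K →* (Lp ℂ 2 μ →L[ℂ] Lp ℂ 2 μ) :=
    { toFun := fun g => LinearMap.mkContinuous
        { toFun := fun x => mk g • x
          map_add' := smul_Lp_add _
          map_smul' := fun r x => smul_comm _ _ _ } 1 fun x => by simp
      map_one' := by
        ext1 x
        change mk (1 : K) • x = x
        rw [mk_one, one_smul]
      -- `DomMulAct` reverses products; commutativity of `K` repairs the order.
      map_mul' := fun g h => by
        ext1 x
        change mk (g * h) • x = mk g • mk h • x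
        rw [mul_comm, mk_mul, mul_smul] }
  have hVapp : ∀ g x, V g x = mk g • x := fun _ _ => rfl
  -- The coefficient of the indicator of `s ⊆ U` is supported in `s / s`. If both `g` and `a * g`
  -- lay there, `a` would be a quotient of two elements of `s / s`.
  obtain ⟨U, hU, hUa⟩ : ∃ U ∈ 𝓝 (1 : K), ∀ x ∈ U, ∀ y ∈ U, ∀ z ∈ U, ∀ w ∈ U,
      x / y / (z / w) ≠ a := by
    have h : ContinuousAt (fun p : (K × K) × (K × K) => p.1.1 / p.1.2 / (p.2.1 / p.2.2))
        ((1, 1), (1, 1)) := by fun_prop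
    have h1 : {a}ᶜ ∈ 𝓝 ((1 : K) / 1 / (1 / 1)) := by simpa using ha.symm
    have h2 := h h1
    rw [Filter.mem_map, nhds_prod_eq, Filter.mem_prod_same_iff] at h2
    obtain ⟨t, ht, hts⟩ := h2
    rw [nhds_prod_eq] at ht
    obtain ⟨U, hU, hUt⟩ := Filter.mem_prod_same_iff.1 ht
    exact ⟨U, hU, fun x hx y hy z hz w hw =>
      hts (Set.mk_mem_prod (hUt (Set.mk_mem_prod hx hy)) (hUt (Set.mk_mem_prod hz hw)))⟩
  obtain ⟨s, hsU, hso, h1s⟩ := mem_nhds_iff.1 hU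
  set k : Lp ℂ 2 μ := indicatorConstLp 2 hso.measurableSet (measure_ne_top μ s) (1 : ℂ) with hk
  have hcoef : ∀ g, inner ℂ (V g k) k ≠ 0 → ∃ x ∈ s, ∃ y ∈ s, g = x / y := fun g hg => by
    by_contra! hne
    refine hg ?_
    rw [hVapp, hk, mk_smul_indicatorConstLp, L2.inner_def]
    refine integral_eq_zero_of_ae ?_
    filter_upwards [indicatorConstLp_coeFn (p := 2) (hs := hso.measurableSet)
        (hμs := measure_ne_top μ s) (c := (1 : ℂ)),
      indicatorConstLp_coeFn (p := 2) (hs := hso.measurableSet.preimage (measurable_const_smul g))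
        (hμs := measure_ne_top μ _) (c := (1 : ℂ))] with x hx1 hx2
    rw [hx1, hx2]
    by_cases hxs : x ∈ s
    · have : x ∉ (g • ·) ⁻¹' s := fun h => hne (g * x) h x hxs (by simp)
      rw [Set.indicator_of_notMem this, inner_zero_left]
      rfl
    · rw [Set.indicator_of_notMem hxs, inner_zero_right]
      rfl
  refine exists_character_apply_ne_one_of_unitaryRepresentation (V := V) (k := k)
    (fun g x => norm_smul_Lp _ _) (fun x => ?_) (fun hk0 => ?_) fun g => ?_
  · exact (continuous_mk.smul continuous_const)
  · have hn : ‖k‖ = 0 := by rw [hk0, norm_zero]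
    rw [hk, norm_indicatorConstLp two_ne_zero (by simp)] at hn
    have : μ.real s = 0 := by simpa [Real.rpow_eq_zero_iff_of_nonneg] using hn
    rw [measureReal_eq_zero_iff] at this
    exact (hso.measure_pos μ ⟨1, h1s⟩).ne' this
  · by_contra! h
    obtain ⟨x, hx, y, hy, hxy⟩ := hcoef _ h.1
    obtain ⟨z, hz, w, hw, hzw⟩ := hcoef _ h.2
    exact hUa z (hsU hz) w (hsU hw) x (hsU hx) y (hsU hy) (by rw [← hxy, ← hzw]; simp)

/-- The topology of a compact Hausdorff abelian group is induced by its continuous characters. -/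
theorem iInf_induced_character_le_of_compactSpace {K : Type*} [CommGroup K]
    [t : TopologicalSpace K] [IsTopologicalGroup K] [CompactSpace K] [T2Space K] :
    ⨅ χ : K →ₜ* Circle, TopologicalSpace.induced χ inferInstance ≤ t := by
  let f : K → (K →ₜ* Circle) → Circle := fun x χ => χ x
  have hf : Continuous f := continuous_pi fun χ => χ.continuous_toFun
  have hinj : Function.Injective f := fun x y hxy => by
    by_contra hne
    obtain ⟨χ, hχ⟩ := exists_character_apply_ne_one (div_ne_one.2 hne)
    have h : χ x = χ y := congrFun hxy χ
    exact hχ (by rw [map_div, h, div_self'])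
  -- A continuous injection of a compact space into a Hausdorff one is a closed embedding.
  refine le_of_le_of_eq ?_ (hf.isClosedEmbedding hinj).isInducing.eq_induced.symm
  simp only [Pi.topologicalSpace, induced_iInf, induced_compose]
  exact le_rfl

end CompactGroup

/-! ### Precompact group topologies. -/

open UniformSpace in
/-- A totally bounded group topology on an abelian group is coarser than (in fact equal to) the
topology induced by its continuous characters. -/
theorem iInf_induced_character_le {A : Type*} [AddCommGroup A] [U : UniformSpace A]
    [IsUniformAddGroup A] (hA : TotallyBounded (Set.univ : Set A)) :
    ⨅ χ : {χ : Multiplicative A →* Circle // Continuous fun a => χ (Multiplicative.ofAdd a)},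
      TopologicalSpace.induced (fun a => χ.1 (Multiplicative.ofAdd a)) inferInstance
        ≤ U.toTopologicalSpace := by
  have : CompactSpace (Completion A) := by
    have h : TotallyBounded (closure (Set.range ((↑) : A → Completion A))) := by
      rw [← Set.image_univ]
      exact (hA.image (Completion.uniformContinuous_coe A)).closure
    rw [Completion.denseRange_coe.closure_range] at h
    exact ⟨h.isCompact_of_isClosed isClosed_univ⟩
  -- `Completion` carries an additive group structure; `Multiplicative` makes the multiplicative
  -- results on compact groups applicable.
  let ι : Multiplicative A →* Multiplicative (Completion A) :=
    AddMonoidHom.toMultiplicative Completion.toCompl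
  have hι : Continuous fun a : A => ι (Multiplicative.ofAdd a) := Completion.continuous_coe A
  have : CompactSpace (Multiplicative (Completion A)) := ‹CompactSpace (Completion A)›
  have : T2Space (Multiplicative (Completion A)) := inferInstanceAs (T2Space (Completion A))
  have h1 : U.toTopologicalSpace = TopologicalSpace.induced
      (fun a : A => ι (Multiplicative.ofAdd a)) inferInstance :=
    (Completion.isUniformInducing_coe A).isInducing.eq_induced
  refine le_of_le_of_eq (le_trans ?_ (induced_mono
    (iInf_induced_character_le_of_compactSpace (K := Multiplicative (Completion A))))) h1.symm
  rw [induced_iInf]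
  refine le_iInf fun χ => iInf_le_of_le
    ⟨(χ : Multiplicative (Completion A) →* Circle).comp ι, χ.continuous_toFun.comp hι⟩ ?_
  rw [induced_compose]
  exact le_rfl

/-- An ultrafilter is Cauchy for the infimum of two uniformities iff it is Cauchy for each. -/
theorem IsPrecompactTopology.inf {G : Type*} [CommGroup G] {τ σ : TopologicalSpace G}
    (hτg : @IsTopologicalGroup G τ _) (hσg : @IsTopologicalGroup G σ _)
    (hτ : IsPrecompactTopology τ) (hσ : IsPrecompactTopology σ) :
    IsPrecompactTopology (τ ⊓ σ) := by
  let U : UniformSpace G := @IsTopologicalGroup.rightUniformSpace G _ τ hτg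
  let W : UniformSpace G := @IsTopologicalGroup.rightUniformSpace G _ σ hσg
  have hU : @IsUniformGroup G U _ := @isUniformGroup_of_commGroup G _ τ hτg
  have hW : @IsUniformGroup G W _ := @isUniformGroup_of_commGroup G _ σ hσg
  have hUt := (isPrecompactTopology_iff U hU).1 hτ
  have hWt := (isPrecompactTopology_iff W hW).1 hσ
  refine (isPrecompactTopology_iff (U ⊓ W) (isUniformGroup_inf hU hW)).2 ?_
  rw [@totallyBounded_iff_ultrafilter G (U ⊓ W)]
  exact fun f hf => cauchy_inf_uniformSpace.2
    ⟨(@totallyBounded_iff_ultrafilter G U _).1 hUt f hf,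
      (@totallyBounded_iff_ultrafilter G W _).1 hWt f hf⟩

theorem isPrecompactTopology_induced {G L : Type*} [CommGroup G] [CommGroup L] [UniformSpace L]
    [IsUniformGroup L] [CompactSpace L] (x : G →* L) :
    IsPrecompactTopology (TopologicalSpace.induced x inferInstance) :=
  (isPrecompactTopology_iff (UniformSpace.comap x inferInstance) (IsUniformGroup.comap x)).2
    (@totallyBounded_preimage G L (UniformSpace.comap x inferInstance) _ x Set.univ
      ((@isUniformInducing_iff_uniformSpace G L (UniformSpace.comap x inferInstance) _ x).2 rfl)
      isCompact_univ.totallyBounded)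

/-! ### Continuous characters of `tauBS S`. -/

/-- The refinement step to be played against maximality of `tauBS S`. Precompactness survives
because the circle is compact. -/
theorem IsTBSTopology.inf_induced {G : Type*} [CommGroup G] {S : Set (ℕ → G)}
    {τ : TopologicalSpace G} (hτ : IsTBSTopology S τ) (x : G →* Circle)
    (hx : ∀ u ∈ S, Tendsto (fun n => x (u n)) atTop (𝓝 1)) :
    IsTBSTopology S (τ ⊓ TopologicalSpace.induced x inferInstance) where
  isTopologicalGroup := topologicalGroup_inf hτ.isTopologicalGroup (topologicalGroup_induced x)
  t2Space := @T2Space.mk G (_) fun y z hyz => by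
    obtain ⟨u, v, hu, hv, h⟩ := @t2_separation G τ hτ.t2Space y z hyz
    exact ⟨u, v, inf_le_left (b := TopologicalSpace.induced x inferInstance) u hu,
      inf_le_left (b := TopologicalSpace.induced x inferInstance) v hv, h⟩
  isPrecompact := hτ.isPrecompact.inf hτ.isTopologicalGroup (topologicalGroup_induced x)
    (isPrecompactTopology_induced x)
  tendsto u hu := by
    rw [nhds_inf, nhds_induced, map_one]
    exact tendsto_inf.2 ⟨hτ.tendsto u hu, tendsto_comap_iff.2 (hx u hu)⟩

/-- The homomorphism `G → 𝕋` underlying a character of the discrete group `G`. -/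
noncomputable def PontryaginDual.toHom {G : Type*} [CommGroup G] (x : PontryaginDual (WithTopology G ⊥)) :
    G →* Circle where
  toFun g := x (WithTopology.toTopology ⊥ g)
  map_one' := _root_.map_one x
  map_mul' g h := _root_.map_mul x (WithTopology.toTopology ⊥ g) (WithTopology.toTopology ⊥ h)

theorem mem_seqSetSubgroup_iff {G : Type*} [CommGroup G] {S : Set (ℕ → G)}
    {x : PontryaginDual (WithTopology G ⊥)} :
    x ∈ seqSetSubgroup S ↔ ∀ u ∈ S, Tendsto (fun n => x.toHom (u n)) atTop (𝓝 1) := by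
  simp only [seqSetSubgroup, Subgroup.mem_iInf]
  rfl

theorem mem_seqSetSubgroup_iff_continuous {G : Type*} [CommGroup G] {S : Set (ℕ → G)}
    (hS : IsTBSSet S) {x : PontryaginDual (WithTopology G ⊥)} :
    x ∈ seqSetSubgroup S ↔ Continuous[tauBS S, inferInstance] x.toHom := by
  have hT := (isLeast_tauBS hS).1
  rw [mem_seqSetSubgroup_iff]
  refine ⟨fun h => continuous_iff_le_induced.2 ?_, fun h u hu => ?_⟩
  -- The refined topology still competes in the infimum, so `tauBS S` is already finer than the
  -- topology induced by `x`.
  · exact ((isLeast_tauBS hS).2 (hT.inf_induced x.toHom h)).trans inf_le_right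
  · have h1 := (@Continuous.tendsto G Circle (tauBS S) _ _ h 1).comp (hT.tendsto u hu)
    rwa [map_one] at h1

/-- A precompact group topology on an abelian group is coarser than (in fact equal to) the weakest
topology making all its continuous characters continuous (Comfort and Ross). -/
theorem IsPrecompactTopology.iInf_induced_le {G : Type*} [CommGroup G] {τ : TopologicalSpace G}
    (hg : @IsTopologicalGroup G τ _) (hτ : IsPrecompactTopology τ) :
    ⨅ χ : {χ : G →* Circle // Continuous[τ, inferInstance] χ},
      TopologicalSpace.induced χ.1 inferInstance ≤ τ := by
  let U : UniformSpace G := @IsTopologicalGroup.rightUniformSpace G _ τ hg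
  have hU : @IsUniformGroup G U _ := @isUniformGroup_of_commGroup G _ τ hg
  have : IsUniformAddGroup (Additive G) := ⟨hU.uniformContinuous_div⟩
  exact iInf_induced_character_le (A := Additive G) ((isPrecompactTopology_iff U hU).1 hτ)

theorem theorem1p2 {G : Type*} [CommGroup G] [Infinite G] (S : Set (ℕ → G)) (hS : IsTBSSet S) :
    (PontryaginDual.map (WithTopology.fromDiscrete G (tauBS S))).toMonoidHom.range
        = seqSetSubgroup S ∧
      tauBS S = weakTopologyOf (seqSetSubgroup S) := by
  constructor
  · ext x
    rw [mem_seqSetSubgroup_iff_continuous hS]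
    constructor
    · rintro ⟨χ, rfl⟩
      exact @Continuous.comp G (WithTopology G (tauBS S)) Circle (tauBS S) _ _ _ (fun g => χ g)
        (map_continuous χ) (WithTopology.continuous_toTopology (t := tauBS S))
    · intro h
      let χ : WithTopology G (tauBS S) →ₜ* Circle :=
        { toFun := fun g => x.toHom g.ofTopology
          map_one' := map_one x.toHom
          map_mul' := fun g h => map_mul x.toHom g.ofTopology h.ofTopology
          continuous_toFun := @Continuous.comp _ _ _ _ (tauBS S) _ _ _ h
            (WithTopology.continuous_ofTopology (t := tauBS S)) }
      exact ⟨χ, PontryaginDual.ext fun _ => rfl⟩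
  · refine le_antisymm (le_iInf₂ fun x hx => continuous_iff_le_induced.1
      ((mem_seqSetSubgroup_iff_continuous hS).1 hx)) ?_
    have hT := (isLeast_tauBS hS).1
    -- By Comfort and Ross it suffices to treat the topology induced by each `tauBS S`-continuous
    -- `χ`; such a `χ` belongs to `seqSetSubgroup S`.
    refine le_trans (le_iInf fun χ => ?_)
      (hT.isPrecompact.iInf_induced_le hT.isTopologicalGroup)
    let x : WithTopology G ⊥ →ₜ* Circle :=
      { toFun := fun g => χ.1 g.ofTopology
        map_one' := map_one χ.1
        map_mul' := fun g h => map_mul χ.1 g.ofTopology h.ofTopology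
        continuous_toFun := continuous_of_discreteTopology }
    have hx : (show PontryaginDual (WithTopology G ⊥) from x) ∈ seqSetSubgroup S :=
      (mem_seqSetSubgroup_iff_continuous hS).2 χ.2
    exact iInf₂_le_of_le _ hx le_rfl
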